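/- Let $n\ge 1$ and $m\ge 1$. There are $n$ rankable objects whose order of arrival is uniformly distributed over all $n!$ permutations. When the $i$-th object arrives, one observes only its relative rank among the first $i$ objects; it is a candidate if it is the best of these. A strategy with $m$ choices selects at most $m$ objects, all of them candidates, and the decision whether to select the $i$-th object depends only on the relative ranks of the first $i$ objects. Consider the following two problems, which have the same set of strategies. (i) The best-choice problem with a random number of objects: only the first $M$ objects are presented, where $M$ is independent of the order of arrival and uniformly distributed on $\{1,\dots,n\}$ (on being presented the $i$-th object one learns about $M$ only that $M\ge i$). One wins if the last object chosen among the presented ones is the best of all $M$ presented objects. The payoff of a strategy is its winning probability. (ii) The scaled duration problem with $n$ objects: all $n$ objects are presented, and the payoff of a strategy is $\frac1n\,\mathbf E\big[\sum_{\tau}(\mathcal T_n(\tau)-\tau)\big]$, where the sum is over the times $\tau$ at which the strategy selects an object, and $\mathcal T_n(\tau)$ is the arrival time of the first candidate after time $\tau$ if there is one, and $n+1$ if there is none. Then the two problems have the same optimal strategies and the same optimal value, and the optimal value is attained in both. Moreover, optimal choices agree in every state: for $1\le i\le n$ and $1\le k\le m$, let $u_i^{(k)}$ (respectively $v_i^{(k)}$)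 be the conditional winning probability in problem (i), given that the $i$-th object is presented and is a candidate, when with $k$ choices remaining one selects (respectively rejects) this object and then continues optimally, and let $w_i^{(k)}=\max\{u_i^{(k)},v_i^{(k)}\}$; let $U_i^{(k)},V_i^{(k)},W_i^{(k)}=\max\{U_i^{(k)},V_i^{(k)}\}$ be the corresponding conditional expected scaled possession times accrued from time $i$ on in problem (ii). Then $w_i^{(k)}=u_i^{(k)}$ if and only if $W_i^{(k)}=U_i^{(k)}$, and $w_i^{(k)}=v_i^{(k)}$ if and only if $W_i^{(k)}=V_i^{(k)}$. -/

import Mathlib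

open MeasureTheory ProbabilityTheory

noncomputable section

namespace ChoiceProblem

/-- Arrival orders of `n` rankable objects. The times are `0, …, n - 1` (one less than in the usual
`1, …, n`), and `ω i` is the absolute rank of the object arriving at time `i`; smaller is
better, so the overall best object is the one with rank `0`. -/
abbrev Order (n : ℕ) : Type := Equiv.Perm (Fin n)

instance (n : ℕ) : MeasurableSpace (Order n) := ⊤

/-- All `n!` arrival orders are equally likely. -/
def orderLaw (n : ℕ) : Measure (Order n) := uniformOn Set.univ

/-- The uniform law on `{1, …, n}`. -/
def uniformLaw (n : ℕ) : Measure ℕ := uniformOn (Set.Icc 1 n)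

/-- The arrival order together with an independent number `M` of objects, uniform on
`{1, …, n}`: only the objects with (zero-based) arrival time less than `M` are presented. -/
def randomNumberLaw (n : ℕ) : Measure (Order n × ℕ) := (orderLaw n).prod (uniformLaw n)

/-- The relative rank of the `i`-th object among those that arrived up to time `i`. -/
def relRank {n : ℕ} (ω : Order n) (i : Fin n) : ℕ :=
  (Finset.univ.filter (fun j : Fin n => j ≤ i ∧ ω j ≤ ω i)).card

/-- A candidate is a relatively best object. -/
def IsCandidate {n : ℕ} (ω : Order n) (i : Fin n) : Prop := relRank ω i = 1

/-- A strategy with at most `k` choices. `chosen ω` is the set of times at which an object would be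
selected if all `n` objects were presented. Whether the `i`-th object is selected depends only on
the relative ranks observed up to time `i`, and only candidates are selected. (The
increasing enumeration of `chosen` is the vector of stopping times.) In the problem with a
random number `M` of objects, the selections actually made are those at times less than
`M`; on being presented the `i`-th object one knows only its relative rank, the earlier relative
ranks, and that it was presented. -/
structure Strategy (n k : ℕ) where
  chosen : Order n → Finset (Fin n)
  nonanticipating : ∀ (ω ω' : Order n) (i : Fin n),
    (∀ j ≤ i, relRank ω j = relRank ω' j) → (i ∈ chosen ω ↔ i ∈ chosen ω')
  candidate : ∀ (ω : Order n), ∀ i ∈ chosen ω, IsCandidate ω i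
  card_le : ∀ ω : Order n, (chosen ω).card ≤ k

/-! ### The best-choice problem with a uniformly distributed number of objects -/

/-- The strategy wins if at least one presented object is chosen and the last chosen one among them
is the best of all presented objects. -/
def Wins {n k : ℕ} (σ : Strategy n k) (ω : Order n) (M : ℕ) : Prop :=
  ∃ j ∈ σ.chosen ω, (j : ℕ) < M ∧
    (∀ l ∈ σ.chosen ω, (l : ℕ) < M → l ≤ j) ∧
    ∀ l : Fin n, (l : ℕ) < M → ω j ≤ ω l

/-- The winning probability of a strategy. -/
def winProb {n k : ℕ} (σ : Strategy n k) : ℝ :=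
  (randomNumberLaw n).real {p | Wins σ p.1 p.2}

/-- The winning probability of a strategy, given that the `i`-th object is presented and is a
candidate. -/
def winProbAt {n k : ℕ} (i : Fin n) (σ : Strategy n k) : ℝ :=
  (cond (randomNumberLaw n) {p | IsCandidate p.1 i ∧ (i : ℕ) < p.2}).real {p | Wins σ p.1 p.2}

/-! ### The duration problem with a fixed number of objects -/

/-- The arrival time of the first candidate after time `i`, and `n` if there is none (`n` is
the first time, counted from zero, after the last arrival). -/
def nextCandidate {n : ℕ} (ω : Order n) (i : Fin n) : ℕ :=
  sInf {t : ℕ | (i : ℕ) < t ∧ (t = n ∨ ∃ h : t < n, IsCandidate ω ⟨t, h⟩)}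

/-- The time for which a candidate selected at time `i` remains a candidate. -/
def duration {n : ℕ} (ω : Order n) (i : Fin n) : ℝ := (nextCandidate ω i : ℝ) - ((i : ℕ) : ℝ)

/-- The total possession time, divided by `n`. -/
def scaledPossession {n k : ℕ} (σ : Strategy n k) (ω : Order n) : ℝ :=
  ∑ i ∈ σ.chosen ω, duration ω i / (n : ℝ)

/-- The expected scaled total possession time of a strategy. -/
def expPossession {n k : ℕ} (σ : Strategy n k) : ℝ :=
  ∫ ω, scaledPossession σ ω ∂(orderLaw n)

/-- The expected scaled total possession time of a strategy, given that the `i`-th object is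
a candidate. -/
def expPossessionAt {n k : ℕ} (i : Fin n) (σ : Strategy n k) : ℝ :=
  ∫ ω, scaledPossession σ ω ∂(cond (orderLaw n) {ω | IsCandidate ω i})

/-! ### Optimality, and the decision in a given state -/

/-- `σ` is optimal for the expected payoff `payoff`. -/
def IsOptimal {n k : ℕ} (payoff : Strategy n k → ℝ) (σ : Strategy n k) : Prop :=
  ∀ σ' : Strategy n k, payoff σ' ≤ payoff σ

/-- The strategies with `k` choices that select the `i`-th object, if it is a candidate, and
make no earlier choice. -/
def selecting {n : ℕ} (i : Fin n) (k : ℕ) : Set (Strategy n k) :=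
  {σ | (∀ ω, ∀ j ∈ σ.chosen ω, i ≤ j) ∧ ∀ ω, IsCandidate ω i → i ∈ σ.chosen ω}

/-- The strategies with `k` choices that reject the `i`-th object and make no earlier choice. -/
def rejecting {n : ℕ} (i : Fin n) (k : ℕ) : Set (Strategy n k) :=
  {σ | ∀ ω, ∀ j ∈ σ.chosen ω, i < j}

/-- The winning probability from the state `(i, k)` (the `i`-th object is a candidate and `k`
choices remain) when the `i`-th object is selected and one then continues optimally. -/
def winSelect {n : ℕ} (i : Fin n) (k : ℕ) : ℝ := sSup (winProbAt i '' selecting i k)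

/-- The winning probability from the state `(i, k)` when the `i`-th object is rejected and one then
continues optimally. -/
def winReject {n : ℕ} (i : Fin n) (k : ℕ) : ℝ := sSup (winProbAt i '' rejecting i k)

/-- The optimal winning probability from the state `(i, k)`. -/
def winValue {n : ℕ} (i : Fin n) (k : ℕ) : ℝ := max (winSelect i k) (winReject i k)

/-- The expected scaled possession time from the state `(i, k)` when the `i`-th object is selected
and one then continues optimally. -/
def possessionSelect {n : ℕ} (i : Fin n) (k : ℕ) : ℝ :=
  sSup (expPossessionAt i '' selecting i k)

/-- The expected scaled possession time from the state `(i, k)` when the `i`-th object is rejected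
and one then continues optimally. -/
def possessionReject {n : ℕ} (i : Fin n) (k : ℕ) : ℝ :=
  sSup (expPossessionAt i '' rejecting i k)

/-- The optimal expected scaled possession time from the state `(i, k)`. -/
def possessionValue {n : ℕ} (i : Fin n) (k : ℕ) : ℝ :=
  max (possessionSelect i k) (possessionReject i k)

end ChoiceProblem

end

namespace ChoiceProblem

variable {n k : ℕ}

/-! Fix the arrival order. With zero-based times, a candidate `j` is the best of the first `M`
objects exactly when `M` lies in the interval from `j` (excluded) to the next candidate (included).
All choices are candidates, so these intervals are disjoint and the strategy wins iff `M` lies in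
one of them (`wins_iff`). For uniform `M` this has probability total length over `n`, the scaled
possession time (`uniformLaw_real_wins`). Averaging over the order makes the two payoffs equal for
every strategy. In a state `(i, k)`, a win already forces `M > i`, so conditioning on presentation
only divides by `P(M > i)`. This positive factor does not depend on the strategy and leaves all
comparisons unchanged. -/

theorem isCandidate_iff (ω : Order n) (i : Fin n) :
    IsCandidate ω i ↔ ∀ j ≤ i, ω i ≤ ω j := by
  have hi : i ∈ Finset.univ.filter (fun j : Fin n => j ≤ i ∧ ω j ≤ ω i) := by simp
  unfold IsCandidate relRank
  constructor
  · intro h j hj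
    by_contra! hlt
    obtain ⟨a, ha⟩ := Finset.card_eq_one.1 h
    have hj' : j ∈ Finset.univ.filter (fun j : Fin n => j ≤ i ∧ ω j ≤ ω i) := by
      simp [hj, hlt.le]
    rw [ha, Finset.mem_singleton] at hi hj'
    rw [hj', ← hi] at hlt
    exact lt_irrefl _ hlt
  · intro h
    refine Finset.card_eq_one.2 ⟨i, Finset.eq_singleton_iff_unique_mem.2 ⟨hi, fun j hj => ?_⟩⟩
    simp only [Finset.mem_filter, Finset.mem_univ, true_and] at hj
    exact ω.injective (le_antisymm hj.2 (h j hj.1))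

theorem nextCandidate_spec (ω : Order n) (i : Fin n) :
    (i : ℕ) < nextCandidate ω i ∧ (nextCandidate ω i = n ∨
      ∃ h : nextCandidate ω i < n, IsCandidate ω ⟨nextCandidate ω i, h⟩) :=
  Nat.sInf_mem (s := {t : ℕ | (i : ℕ) < t ∧ (t = n ∨ ∃ h : t < n, IsCandidate ω ⟨t, h⟩)})
    ⟨n, i.isLt, Or.inl rfl⟩

theorem lt_nextCandidate (ω : Order n) (i : Fin n) : (i : ℕ) < nextCandidate ω i :=
  (nextCandidate_spec ω i).1

theorem nextCandidate_le (ω : Order n) (i : Fin n) : nextCandidate ω i ≤ n :=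
  Nat.sInf_le ⟨i.isLt, Or.inl rfl⟩

theorem nextCandidate_le_of_isCandidate {ω : Order n} {i j : Fin n} (hij : i < j)
    (hj : IsCandidate ω j) : nextCandidate ω i ≤ j :=
  Nat.sInf_le ⟨hij, Or.inr ⟨j.isLt, hj⟩⟩

/-- A candidate is the best of the first `M` objects until the next candidate arrives. -/
theorem best_of_presented_iff {ω : Order n} {j : Fin n} (hj : IsCandidate ω j) {M : ℕ}
    (hjM : (j : ℕ) < M) (hM : M ≤ n) :
    (∀ l : Fin n, (l : ℕ) < M → ω j ≤ ω l) ↔ M ≤ nextCandidate ω j := by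
  constructor
  · intro h
    by_contra! hlt
    -- The next candidate would be among the first `M` objects and beat `j`.
    obtain ⟨h1, h2 | ⟨hn, hc⟩⟩ := nextCandidate_spec ω j
    · omega
    · have hle := (isCandidate_iff ω _).1 hc j (Fin.le_def.2 h1.le)
      have heq := congrArg Fin.val (ω.injective (le_antisymm (h _ hlt) hle))
      simp only at heq
      omega
  · intro h
    -- The best presented object `a` is a candidate, and no candidate arrives after `j` but before
    -- `M`; so `a ≤ j`, and `j` is at least as good as `a`.
    obtain ⟨a, ha, hmin⟩ := Finset.exists_min_image
      (Finset.univ.filter (fun l : Fin n => (l : ℕ) < M)) ω ⟨j, by simpa using hjM⟩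
    simp only [Finset.mem_filter, Finset.mem_univ, true_and] at ha hmin
    have hac : IsCandidate ω a :=
      (isCandidate_iff ω a).2 fun l hl => hmin l (lt_of_le_of_lt (Fin.le_def.1 hl) ha)
    have haj : a ≤ j := by
      by_contra! hlt
      have := nextCandidate_le_of_isCandidate hlt hac
      omega
    exact fun l hl => ((isCandidate_iff ω j).1 hj a haj).trans (hmin l hl)

theorem wins_iff (σ : Strategy n k) (ω : Order n) {M : ℕ} (hM : M ≤ n) :
    Wins σ ω M ↔ ∃ j ∈ σ.chosen ω, M ∈ Finset.Ioc (j : ℕ) (nextCandidate ω j) := by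
  simp only [Finset.mem_Ioc]
  constructor
  · rintro ⟨j, hj, hjM, -, hbest⟩
    exact ⟨j, hj, hjM, (best_of_presented_iff (σ.candidate ω j hj) hjM hM).1 hbest⟩
  · rintro ⟨j, hj, hjM, hle⟩
    refine ⟨j, hj, hjM, fun l hl hlM => ?_,
      (best_of_presented_iff (σ.candidate ω j hj) hjM hM).2 hle⟩
    -- A later presented choice would itself be a candidate, ending the interval of `j` before `M`.
    by_contra! hlt
    have := nextCandidate_le_of_isCandidate hlt (σ.candidate ω l hl)
    omega

theorem uniformLaw_real (n : ℕ) (s : Set ℕ) (t : Finset ℕ)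
    (hst : ∀ M, M ∈ t ↔ M ∈ Set.Icc 1 n ∧ M ∈ s) :
    (uniformLaw n).real s = (t.card : ℝ) / n := by
  have hst' : Set.Icc 1 n ∩ s = (t : Set ℕ) := by
    ext M
    simp only [Set.mem_inter_iff, Finset.mem_coe, hst]
  have hcard : (Set.Icc 1 n : Set ℕ) = ((Finset.Icc 1 n : Finset ℕ) : Set ℕ) := by simp
  rw [measureReal_def, uniformLaw, uniformOn, cond_apply MeasurableSet.of_discrete, hst', hcard,
    Measure.count_apply_finset, Measure.count_apply_finset]
  simp [ENNReal.toReal_mul, div_eq_inv_mul]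

/-- Given the arrival order, the winning probability is the scaled possession time. -/
theorem uniformLaw_real_wins (σ : Strategy n k) (ω : Order n) :
    (uniformLaw n).real {M | Wins σ ω M} = scaledPossession σ ω := by
  rw [uniformLaw_real n _
    ((σ.chosen ω).biUnion fun j => Finset.Ioc (j : ℕ) (nextCandidate ω j)), Finset.card_biUnion]
  · simp only [Nat.card_Ioc, Nat.cast_sum, scaledPossession, duration, Finset.sum_div]
    refine Finset.sum_congr rfl fun j _ => ?_
    rw [Nat.cast_sub (lt_nextCandidate ω j).le]
  · intro a ha b hb hab
    refine Finset.disjoint_left.2 ?_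
    intro M h1 h2
    simp only [Finset.mem_Ioc] at h1 h2
    rcases lt_or_gt_of_ne hab with h | h
    · have := nextCandidate_le_of_isCandidate h (σ.candidate ω b hb)
      omega
    · have := nextCandidate_le_of_isCandidate h (σ.candidate ω a ha)
      omega
  · intro M
    simp only [Finset.mem_biUnion, Set.mem_Icc, Set.mem_ofPred_eq]
    constructor
    · rintro ⟨j, hj, hM⟩
      have hM' := Finset.mem_Ioc.1 hM
      have hle := hM'.2.trans (nextCandidate_le ω j)
      exact ⟨⟨by omega, hle⟩, (wins_iff σ ω hle).2 ⟨j, hj, hM⟩⟩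
    · rintro ⟨⟨-, hle⟩, hw⟩
      exact (wins_iff σ ω hle).1 hw

instance isFiniteMeasure_orderLaw (n : ℕ) : IsFiniteMeasure (orderLaw n) := by
  unfold orderLaw; infer_instance

instance isFiniteMeasure_uniformLaw (n : ℕ) : IsFiniteMeasure (uniformLaw n) := by
  unfold uniformLaw uniformOn; infer_instance

theorem randomNumberLaw_real (s : Set (Order n × ℕ)) :
    (randomNumberLaw n).real s = ∫ ω, (uniformLaw n).real (Prod.mk ω ⁻¹' s) ∂orderLaw n := by
  rw [measureReal_def, randomNumberLaw, Measure.prod_apply (MeasurableSet.of_discrete)]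
  simp only [measureReal_def]
  rw [integral_toReal (Measurable.of_discrete).aemeasurable
    (Filter.Eventually.of_forall fun _ => measure_lt_top _ _)]

/-- Fubini: `M` is independent of the order, so the pointwise identity integrates. -/
theorem winProb_eq_expPossession (σ : Strategy n k) : winProb σ = expPossession σ := by
  rw [winProb, expPossession, randomNumberLaw_real]
  exact integral_congr_ae (Filter.Eventually.of_forall fun ω => uniformLaw_real_wins σ ω)

theorem uniformLaw_real_presented_pos (i : Fin n) : 0 < (uniformLaw n).real {M | (i : ℕ) < M} := by
  rw [uniformLaw_real n _ (Finset.Ioc (i : ℕ) n) (fun M => by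
    simp only [Finset.mem_Ioc, Set.mem_Icc, Set.mem_ofPred_eq]; omega)]
  have hi := i.isLt
  have h0 : 0 < n := by omega
  have h1 : 0 < (Finset.Ioc (i : ℕ) n).card := by simp
  positivity

/-- Conditionally on a candidate at time `i`, the two payoffs of a strategy without earlier choices
differ by the probability that the `i`-th object is presented. -/
theorem winProbAt_eq_mul_expPossessionAt (i : Fin n) (σ : Strategy n k)
    (hσ : ∀ ω, ∀ j ∈ σ.chosen ω, i ≤ j) :
    winProbAt i σ = ((uniformLaw n).real {M | (i : ℕ) < M})⁻¹ * expPossessionAt i σ := by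
  have hprod : {p : Order n × ℕ | IsCandidate p.1 i ∧ (i : ℕ) < p.2} =
      {ω : Order n | IsCandidate ω i} ×ˢ {M : ℕ | (i : ℕ) < M} := rfl
  have hinter : (randomNumberLaw n).real ({p : Order n × ℕ | IsCandidate p.1 i ∧ (i : ℕ) < p.2} ∩
      {p | Wins σ p.1 p.2}) = ∫ ω in {ω | IsCandidate ω i}, scaledPossession σ ω ∂orderLaw n := by
    rw [randomNumberLaw_real, ← integral_indicator MeasurableSet.of_discrete]
    refine integral_congr_ae (Filter.Eventually.of_forall fun ω => ?_)
    by_cases hω : IsCandidate ω i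
    · rw [Set.indicator_of_mem (show ω ∈ {ω | IsCandidate ω i} from hω), ← uniformLaw_real_wins]
      refine congrArg (uniformLaw n).real (Set.ext fun M => ?_)
      simp only [Set.mem_preimage, Set.mem_inter_iff, Set.mem_ofPred_eq, hω, true_and,
        and_iff_right_iff_imp]
      -- The winning choice satisfies `i ≤ j < M`, so the `i`-th object is presented.
      rintro ⟨j, hj, hjM, -⟩
      exact lt_of_le_of_lt (Fin.le_def.1 (hσ ω j hj)) hjM
    · rw [Set.indicator_of_notMem (show ω ∉ {ω | IsCandidate ω i} from hω)]
      simp [hω]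
  rw [winProbAt, expPossessionAt, measureReal_def, cond_apply MeasurableSet.of_discrete,
    ENNReal.toReal_mul, ENNReal.toReal_inv, ← measureReal_def, ← measureReal_def, hinter, hprod,
    randomNumberLaw, measureReal_prod_prod, ProbabilityTheory.cond, integral_smul_measure,
    smul_eq_mul, ENNReal.toReal_inv, ← measureReal_def, mul_inv]
  ring

theorem sSup_winProbAt_image (i : Fin n) (S : Set (Strategy n k))
    (hS : ∀ σ ∈ S, ∀ ω, ∀ j ∈ σ.chosen ω, i ≤ j) :
    sSup (winProbAt i '' S) =
      ((uniformLaw n).real {M | (i : ℕ) < M})⁻¹ * sSup (expPossessionAt i '' S) := by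
  -- A nonnegative factor commutes with the real `sSup` of any set, so neither boundedness nor
  -- nonemptiness has to be checked.
  rw [← smul_eq_mul, ← Real.sSup_smul_of_nonneg (inv_nonneg.2 measureReal_nonneg),
    ← Set.image_smul, Set.image_image]
  congr 1
  exact Set.image_congr fun σ hσ => winProbAt_eq_mul_expPossessionAt i σ (hS σ hσ)

theorem winSelect_eq (i : Fin n) (k : ℕ) :
    winSelect i k = ((uniformLaw n).real {M | (i : ℕ) < M})⁻¹ * possessionSelect i k :=
  sSup_winProbAt_image i _ fun _ hσ => hσ.1

theorem winReject_eq (i : Fin n) (k : ℕ) :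
    winReject i k = ((uniformLaw n).real {M | (i : ℕ) < M})⁻¹ * possessionReject i k :=
  sSup_winProbAt_image i _ fun _ hσ ω j hj => (hσ ω j hj).le

theorem winValue_eq (i : Fin n) (k : ℕ) :
    winValue i k = ((uniformLaw n).real {M | (i : ℕ) < M})⁻¹ * possessionValue i k := by
  rw [winValue, possessionValue, winSelect_eq, winReject_eq,
    mul_max_of_nonneg _ _ (inv_nonneg.2 measureReal_nonneg)]

/-- Finiteness is what makes the optimal value attained. -/
instance finite_strategy (n k : ℕ) : Finite (Strategy n k) :=
  Finite.of_injective (Strategy.chosen : Strategy n k → Order n → Finset (Fin n)) (by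
    rintro ⟨_, _, _, _⟩ ⟨_, _, _, _⟩ h
    cases h
    rfl)

instance nonempty_strategy (n k : ℕ) : Nonempty (Strategy n k) :=
  ⟨{ chosen := fun _ => ∅
     nonanticipating := by simp
     candidate := by simp
     card_le := by simp }⟩

end ChoiceProblem

theorem theorem3 (n m : ℕ) (hn : 1 ≤ n) (hm : 1 ≤ m) :
    -- the same strategies are optimal in the two problems
    (∀ σ : ChoiceProblem.Strategy n m,
      ChoiceProblem.IsOptimal ChoiceProblem.winProb σ ↔
        ChoiceProblem.IsOptimal ChoiceProblem.expPossession σ) ∧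
    -- both optimal values are attained, and they are equal
    (∃ v : ℝ,
      IsGreatest (Set.range (ChoiceProblem.winProb : ChoiceProblem.Strategy n m → ℝ)) v ∧
      IsGreatest (Set.range (ChoiceProblem.expPossession : ChoiceProblem.Strategy n m → ℝ)) v) ∧
    -- in every state, selecting (rejecting) is optimal in one problem iff it is in the other
    (∀ (i : Fin n) (k : ℕ), 1 ≤ k → k ≤ m →
      (ChoiceProblem.winValue i k = ChoiceProblem.winSelect i k ↔
        ChoiceProblem.possessionValue i k = ChoiceProblem.possessionSelect i k) ∧
      (ChoiceProblem.winValue i k = ChoiceProblem.winReject i k ↔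
        ChoiceProblem.possessionValue i k = ChoiceProblem.possessionReject i k)) := by
  have hpay : (ChoiceProblem.winProb : ChoiceProblem.Strategy n m → ℝ) =
      ChoiceProblem.expPossession := funext ChoiceProblem.winProb_eq_expPossession
  refine ⟨fun σ => by rw [hpay], ?_, fun i k _ _ => ?_⟩
  · obtain ⟨σ, hσ⟩ :=
      Finite.exists_max (ChoiceProblem.expPossession : ChoiceProblem.Strategy n m → ℝ)
    have hmax : IsGreatest (Set.range
        (ChoiceProblem.expPossession : ChoiceProblem.Strategy n m → ℝ))
        (ChoiceProblem.expPossession σ) := ⟨⟨σ, rfl⟩, by rintro _ ⟨σ', rfl⟩; exact hσ σ'⟩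
    exact ⟨_, by rw [hpay]; exact hmax, hmax⟩
  -- The common factor `1 / P(M > i)` is nonzero and cancels from both equations.
  · have hc := inv_ne_zero (ChoiceProblem.uniformLaw_real_presented_pos i).ne'
    rw [ChoiceProblem.winValue_eq, ChoiceProblem.winSelect_eq, ChoiceProblem.winReject_eq,
      mul_right_inj' hc, mul_right_inj' hc]
    exact ⟨Iff.rfl, Iff.rfl⟩
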